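/- Let $n\ge 1$. All manifolds are smooth, finite-dimensional, Hausdorff and second countable. A *regular graded Dirac structure of order $n$* on a manifold $M$ consists of smooth vector subbundles $S^a\subseteq\bigwedge^aT^*M$, $1\le a\le n$, with $S^{a}=\langle\iota_v\alpha: v\in TM,\ \alpha\in S^{a+1}\rangle$ for $1\le a<n$, and vector bundle maps $\sharp_a:S^a\to \bigwedge^{n+1-a}TM/K_{n+1-a}$, where $K_p=\{U\in\bigwedge^pTM:\iota_US^p=0\}$, such that (i) $\iota_{\sharp_a(\alpha)}\beta=(-1)^{(n+1-a)(n+1-b)}\iota_{\sharp_b(\beta)}\alpha$ for $\alpha\in S^a,\beta\in S^b$, and (ii) for sections $\alpha$ of $S^a$ and $\beta$ of $S^b$ with $a+b\ge n+1$, and multivector fields $U,V$ of degrees $p=n+1-a$, $q=n+1-b$ representing $\sharp_a(\alpha)$, $\sharp_b(\beta)$, the form $\theta=(-1)^{(p-1)q}\pounds_U\beta+(-1)^q\pounds_V\alpha-\frac{(-1)^q}{2}d\big(\iota_V\alpha+(-1)^{pq}\iota_U\beta\big)$ takes values in $S^{a+b-n}$ and $\sharp_{a+b-n}(\theta)=[U,V]+K_{p+q-1}$.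 Here $\iota_{u\wedge v}=\iota_v\iota_u$, $\pounds_U=d\iota_U-(-1)^p\iota_Ud$, and $[U,V]$ is the Schouten–Nijenhuis bracket, with $\iota_{[U,V]}=(-1)^{(p-1)q}\pounds_U\iota_V-\iota_V\pounds_U$. Let $\tau:M\to X$ be a surjective submersion onto an $n$-dimensional manifold. A form is *semi-basic* if it is annihilated by contraction with vertical vectors (those in $\ker d\tau$). Assume that the structure is *fibered over $X$*: for $1\le a\le n$, every element of $S^a$ vanishes when contracted with two vertical vectors, and every semi-basic $a$-form lies in $S^a$. For $0\le a\le n-1$ let $\Omega^a_H(M)$ be the set of smooth $a$-forms $\alpha$ such that $d\alpha$ takes values in $S^{a+1}$. Let $(S^1)^{\wedge b}$ be the span of the $b$-fold wedge products of elements of $S^1$, and let $\widetilde\sharp_1:(S^1)^{\wedge b}\to\bigwedge^{b-1}T^*M\otimes\bigwedge^nTM/K_n$ be the unique map with $\iota_{\sharp_n(\alpha)}\beta=(-1)^{n+1-b}\iota_{\widetilde\sharp_1(\beta)}\alpha$ for all $\alpha\in S^n$, $\beta\in(S^1)^{\wedge b}$, where $\iota_{\theta\otimes u}\alpha=\theta\wedge\iota_u\alpha$.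 Let $S^{n+1}[n]$ be the set of those $\Theta\in(S^1)^{\wedge(n+1)}$ for which there is $N\in T^*M\otimes TM/K_1$ with $\iota_N\alpha=\iota_{\widetilde\sharp_1(\Theta)}\alpha$ for all $\alpha\in S^n$. An *extension* is a smooth fibrewise linear map $\widetilde\sharp_n:S^{n+1}[n]\to T^*M\otimes TM/K_1$ with $\iota_{\widetilde\sharp_n(\Theta)}\alpha=\iota_{\widetilde\sharp_1(\Theta)}\alpha$ for all $\Theta\in S^{n+1}[n]$, $\alpha\in S^n$. A *Hamiltonian* is a smooth $n$-form $\mathcal H$ such that $d\mathcal H$ takes values in $S^{n+1}[n]$, the $\bigwedge^nTM/K_n$-valued form $-\widetilde\sharp_1(d\mathcal H)+\mathbb 1_n$ is semi-basic, and $\iota_{-\widetilde\sharp_1(d\mathcal H)+\mathbb 1_n}\omega=\omega$ for every semi-basic $n$-form $\omega$; here $\mathbb 1_n$ is the identity of $\bigwedge^nTM$, taken modulo $K_n$. With $\deg_H\mathcal H=(n-1)-n=-1$, put $$\{\alpha,\mathcal H\}_{\widetilde\sharp_1}=(-1)^{\deg_H\mathcal H}\iota_{\widetilde\sharp_1(d\mathcal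 H)}d\alpha\quad(\alpha\in\Omega_H^{n-1}(M)),\qquad \{\alpha,\mathcal H\}_{\widetilde\sharp_n}=(-1)^{\deg_H\mathcal H}\iota_{\widetilde\sharp_n(d\mathcal H)}d\alpha\quad(\alpha\in\Omega_H^{a}(M)).$$ **Theorem.** Let $\mathcal H$ be a Hamiltonian and let $\widetilde\sharp_n$ be an extension such that $\widetilde\sharp_n(d\mathcal H)$ takes vertical values, i.e. values in $\ker d\tau$ modulo $K_1$. Let $\gamma_{\mathcal H}:\tau^*TX\to TM/K_1$ be the transpose of the map $S^1\to\tau^*T^*X$, $\theta\mapsto\theta-\iota_{\widetilde\sharp_n(d\mathcal H)}\theta$. Let $h$ be an Ehresmann connection on $\tau$ whose horizontal lift $h:\tau^*TX\to TM$ equals $\gamma_{\mathcal H}$ modulo $K_1$, and write $(h^*\eta)(v_1,\dots,v_k)=\eta(h(d\tau\,v_1),\dots,h(d\tau\,v_k))$. Then $h$ solves the Hamilton–De Donder–Weyl equations of $\mathcal H$, that is, $h^*(d\alpha)=d\alpha+\{\alpha,\mathcal H\}_{\widetilde\sharp_1}$ for every $\alpha\in\Omega^{n-1}_H(M)$; moreover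 $$h^*(d\alpha)=d\alpha+\{\alpha,\mathcal H\}_{\widetilde\sharp_n}$$ for every $\alpha\in\Omega^a_H(M)$ and every $0\le a\le n-1$. -/

import Mathlib

open scoped Manifold ContDiff Topology

noncomputable section

namespace GradedDirac

/-! ### Linear algebra on one tangent space -/

section Pointwise

variable {V : Type*} [AddCommGroup V] [Module ℝ V]

/-- `k`-forms on the vector space `V`. -/
abbrev Form (V : Type*) [AddCommGroup V] [Module ℝ V] (k : ℕ) := V [⋀^Fin k]→ₗ[ℝ] ℝ

/-- Inhomogeneous forms on `V`: one component in each degree. -/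
abbrev GForm (V : Type*) [AddCommGroup V] [Module ℝ V] := ∀ k : ℕ, Form V k

/-- The contraction `ι_u η` of a form with a multivector: forms are the linear functionals on the
exterior algebra, and `(ι_u η)(w) = η(u ∧ w)`. Thus `ι_{v ∧ w} = ι_w ι_v`. -/
def contract (u : ExteriorAlgebra ℝ V) (η : GForm V) : GForm V :=
  ExteriorAlgebra.liftAlternatingEquiv.symm
    (ExteriorAlgebra.liftAlternating η ∘ₗ LinearMap.mulLeft ℝ u)

/-- `(ι_{u₁ ∧ ⋯ ∧ u_p} η)(v₁, …, v_k) = η(u₁, …, u_p, v₁, …, v_k)`. -/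
theorem contract_ιMulti {p k : ℕ} (u : Fin p → V) (η : GForm V) (v : Fin k → V) :
    contract (ExteriorAlgebra.ιMulti ℝ p u) η k v = η (p + k) (Fin.append u v) := by
  have h : ExteriorAlgebra.ιMulti ℝ p u * ExteriorAlgebra.ιMulti ℝ k v
      = ExteriorAlgebra.ιMulti ℝ (p + k) (Fin.append u v) := by
    simp [ExteriorAlgebra.ιMulti_apply, ← List.prod_append, ← List.ofFn_fin_append]
    congr 2
    ext i
    refine Fin.addCases (fun j => ?_) (fun j => ?_) i <;> simp
  simp [contract, ExteriorAlgebra.liftAlternatingEquiv, h,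
    ExteriorAlgebra.liftAlternating_apply_ιMulti]

/-- A homogeneous form regarded as an inhomogeneous one. -/
def homog {k : ℕ} (α : Form V k) : GForm V := Pi.single k α

/-- The annihilator `K_p = {U : ι_U S^p = 0}` inside the `p`-vectors; for a `p`-vector `U` and a
`p`-form `α`, `ι_U α` is the number `⟨α, U⟩`. -/
def annih (S : ∀ k, Submodule ℝ (Form V k)) (p : ℕ) : Submodule ℝ (⋀[ℝ]^p V) where
  carrier := {U | ∀ α ∈ S p, exteriorPower.alternatingMapLinearEquiv α U = 0}
  add_mem' hU hW α hα := by simp [hU α hα, hW α hα]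
  zero_mem' α _ := by simp
  smul_mem' c U hU α hα := by simp [hU α hα]

/-- The quotient `⋁_p V / K_p`. -/
abbrev MVQuot (S : ∀ k, Submodule ℝ (Form V k)) (p : ℕ) := (⋀[ℝ]^p V) ⧸ annih S p

/-- The annihilator `K_1`, as a subspace of `V`. -/
def annihVec (S : ∀ k, Submodule ℝ (Form V k)) : Submodule ℝ V where
  carrier := {v | ∀ θ ∈ S 1, θ (fun _ => v) = 0}
  add_mem' {v w} hv hw θ hθ := by
    have h := (AlternatingMap.ofSubsingleton ℝ V ℝ (0 : Fin 1)).symm θ |>.map_add v w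
    simp only [AlternatingMap.ofSubsingleton_symm_apply_apply] at h
    exact h.trans (by simpa using congrArg₂ (· + ·) (hv θ hθ) (hw θ hθ))
  zero_mem' θ _ := θ.map_coord_zero 0 rfl
  smul_mem' c v hv θ hθ := by
    have h := (AlternatingMap.ofSubsingleton ℝ V ℝ (0 : Fin 1)).symm θ |>.map_smul c v
    simp only [AlternatingMap.ofSubsingleton_symm_apply_apply] at h
    exact h.trans (by simpa using Or.inr (hv θ hθ))

end Pointwise

/-- The value at a point of a graded Dirac structure of order `n`: spaces `S^a` of `a`-forms
(only `1 ≤ a ≤ n` matters) with `S^a = ι_V S^{a+1}`, and skew-symmetric linear maps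
`♯_a : S^a → ⋁_p V / K_p`, `p = n + 1 - a`. -/
structure LinearDirac (V : Type*) [AddCommGroup V] [Module ℝ V] (n : ℕ) where
  S : ∀ k, Submodule ℝ (Form V k)
  chain : ∀ a, 1 ≤ a → a < n →
    S a = Submodule.span ℝ {β | ∃ α ∈ S (a + 1), ∃ v : V, β = α.curryLeft v}
  sharp : ∀ a p : ℕ, a + p = n + 1 → S a →ₗ[ℝ] MVQuot S p
  skew : ∀ (a b p q : ℕ) (ha : a + p = n + 1) (hb : b + q = n + 1),
    1 ≤ a → 1 ≤ b → 1 ≤ p → 1 ≤ q →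
    ∀ (α : S a) (β : S b) (U : ⋀[ℝ]^p V) (W : ⋀[ℝ]^q V),
      sharp a p ha α = Submodule.Quotient.mk U → sharp b q hb β = Submodule.Quotient.mk W →
      contract (U : ExteriorAlgebra ℝ V) (homog β.1)
        = (-1 : ℝ) ^ (p * q) • contract (W : ExteriorAlgebra ℝ V) (homog α.1)

namespace LinearDirac

variable {V : Type*} [AddCommGroup V] [Module ℝ V] {n : ℕ} (D : LinearDirac V n)

/-- `K_1 ⊆ V`. -/
abbrev K₁ : Submodule ℝ V := annihVec D.S

/-- `♯_n : S^n → V / K_1`, through the identification of `1`-vectors with vectors. -/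
def sharpTop : D.S n →ₗ[ℝ] V ⧸ D.K₁ :=
  Submodule.mapQ (annih D.S 1) D.K₁ (exteriorPower.oneEquiv ℝ V).toLinearMap (by
      intro U hU θ hθ
      have h := hU θ hθ
      obtain ⟨v, rfl⟩ := (exteriorPower.oneEquiv ℝ V).symm.surjective U
      have hv : (exteriorPower.oneEquiv ℝ V).symm v = exteriorPower.ιMulti ℝ 1 (fun _ => v) := by
        rw [LinearEquiv.symm_apply_eq, exteriorPower.oneEquiv_ιMulti]
      rw [hv, exteriorPower.alternatingMapLinearEquiv_apply_ιMulti] at h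
      simpa using h) ∘ₗ D.sharp n 1 rfl

/-- `(S^1)^{∧ b}`: the span of the products `θ₁ ∧ ⋯ ∧ θ_b` with `θ_i ∈ S^1`. -/
def wedgePow (b : ℕ) : Submodule ℝ (Form V b) :=
  Submodule.span ℝ {β | ∃ θ : Fin b → Form V 1, (∀ i, θ i ∈ D.S 1) ∧
    ∀ v : Fin b → V, β v = Matrix.det (Matrix.of fun i j => θ i (fun _ => v j))}

/-- The `(k+1)`-forms `β` with `ι_{K_1} β = 0`. -/
def killed (k : ℕ) : Submodule ℝ (Form V (k + 1)) where
  carrier := {β | ∀ v ∈ D.K₁, β.curryLeft v = 0}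
  add_mem' hα hβ v hv := by simp [hα v hv, hβ v hv]
  zero_mem' v _ := by simp
  smul_mem' c β hβ v hv := by simp [hβ v hv]

theorem wedgePow_le_killed (k : ℕ) : D.wedgePow (k + 1) ≤ D.killed k := by
  refine Submodule.span_le.2 ?_
  rintro β ⟨θ, hθ, hβ⟩ v hv
  ext w
  rw [AlternatingMap.curryLeft_apply_apply, hβ]
  exact Matrix.det_eq_zero_of_column_eq_zero 0 fun i => by simpa using hv (θ i) (hθ i)

theorem S_le_killed (k : ℕ) (hk : k + 1 ≤ n) : D.S (k + 1) ≤ D.killed k := by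
  induction k with
  | zero =>
    intro β hβ v hv
    ext w
    have h := hv β hβ
    rw [AlternatingMap.curryLeft_apply_apply]
    have hw : Matrix.vecCons v w = fun _ => v := by
      ext i
      rw [Subsingleton.elim i 0]; rfl
    rw [hw]
    exact h
  | succ k ih =>
    intro β hβ v hv
    ext w
    have h1 : β.curryLeft (w 0) ∈ D.S (k + 1) := by
      rw [D.chain (k + 1) (by omega) (by omega)]
      exact Submodule.subset_span ⟨β, hβ, w 0, rfl⟩
    have h2 := DFunLike.congr_fun (ih (by omega) h1 v hv) (Matrix.vecTail w)
    have h3 := β.map_swap (Matrix.vecCons (w 0) (Matrix.vecCons v (Matrix.vecTail w)))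
      (show (0 : Fin (k + 2)) ≠ 1 by simp)
    have h4 : (Matrix.vecCons (w 0) (Matrix.vecCons v (Matrix.vecTail w))) ∘ Equiv.swap (0 : Fin (k + 2)) 1
        = Matrix.vecCons v w := by
      ext i
      refine Fin.cases ?_ (fun i => ?_) i
      · simp
      · refine Fin.cases ?_ (fun i => ?_) i
        · simp [Matrix.vecCons]
        · have : Equiv.swap (0 : Fin (k + 2)) 1 i.succ.succ = i.succ.succ :=
            Equiv.swap_apply_of_ne_of_ne (by simp [Fin.ext_iff]) (by simp [Fin.ext_iff])
          simp [this, Matrix.vecTail]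
    rw [h4] at h3
    simp only [AlternatingMap.curryLeft_apply_apply, AlternatingMap.zero_apply] at h2 ⊢
    rw [h3, h2, neg_zero]

/-- `ι_{v + K_1} β` for `β` with `ι_{K_1} β = 0`. -/
def contractVec (k : ℕ) : D.killed k →ₗ[ℝ] (V ⧸ D.K₁) →ₗ[ℝ] Form V k where
  toFun β := Submodule.liftQ D.K₁ β.1.curryLeft fun v hv => β.2 v hv
  map_add' β β' := by ext v w; rfl
  map_smul' c β := by ext v w; rfl

/-- The contraction `ι_N β` with `N ∈ V^* ⊗ V / K_1`, viewed as a linear map `V → V / K_1`;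
it is the alternating form `∑_i (-1)^i (ι_{N v_i} β)(v_0, …, v̂_i, …, v_k)`, so that
`ι_{θ ⊗ u} β = θ ∧ ι_u β`. -/
def iotaVec (k : ℕ) : (V →ₗ[ℝ] V ⧸ D.K₁) →ₗ[ℝ] D.killed k →ₗ[ℝ] Form V (k + 1) :=
  LinearMap.mk₂ ℝ (fun N β => AlternatingMap.alternatizeUncurryFin (D.contractVec k β ∘ₗ N))
    (fun N N' β => by rw [LinearMap.comp_add, AlternatingMap.alternatizeUncurryFin_add])
    (fun c N β => by rw [LinearMap.comp_smul, AlternatingMap.alternatizeUncurryFin_smul])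
    (fun N β β' => by
      rw [map_add, LinearMap.add_comp, AlternatingMap.alternatizeUncurryFin_add])
    (fun c N β => by
      rw [map_smul, LinearMap.smul_comp, AlternatingMap.alternatizeUncurryFin_smul])

/-- The pairing of `⋁_p V / K_p` with `S^p`. -/
def evalQuot (p : ℕ) : MVQuot D.S p →ₗ[ℝ] Module.Dual ℝ (D.S p) :=
  Submodule.liftQ (annih D.S p)
    (LinearMap.flip
      (exteriorPower.alternatingMapLinearEquiv.toLinearMap ∘ₗ (D.S p).subtype))
    (fun _ hU => LinearMap.ext fun α => hU α.1 α.2)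

theorem evalQuot_bijective [FiniteDimensional ℝ V] (p : ℕ) :
    Function.Bijective (D.evalQuot p) := by
  constructor
  · rw [← LinearMap.ker_eq_bot]
    refine Submodule.ker_liftQ_eq_bot _ _ _ fun U hU α hα => ?_
    exact LinearMap.congr_fun hU ⟨α, hα⟩
  · intro f
    set i : D.S p →ₗ[ℝ] Module.Dual ℝ (⋀[ℝ]^p V) :=
      exteriorPower.alternatingMapLinearEquiv.toLinearMap ∘ₗ (D.S p).subtype with hi
    have hinj : Function.Injective i :=
      exteriorPower.alternatingMapLinearEquiv.injective.comp Subtype.val_injective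
    obtain ⟨G, hG⟩ : ∃ G : Module.Dual ℝ (Module.Dual ℝ (⋀[ℝ]^p V)), G ∘ₗ i = f := by
      have hk : LinearMap.ker i = ⊥ := by
        rw [LinearMap.ker_eq_bot']
        exact fun a ha => hinj (ha.trans (map_zero i).symm)
      obtain ⟨g, hg⟩ := LinearMap.exists_leftInverse_of_injective (K := ℝ) (V := D.S p)
        (V' := Module.Dual ℝ (⋀[ℝ]^p V)) i hk
      exact ⟨f ∘ₗ g, by rw [LinearMap.comp_assoc, hg, LinearMap.comp_id]⟩
    obtain ⟨U, hU⟩ := (Module.evalEquiv ℝ (⋀[ℝ]^p V)).surjective G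
    refine ⟨Submodule.Quotient.mk U, ?_⟩
    rw [← hG, ← hU]
    rfl

/-- The isomorphism `⋁_p V / K_p ≃ (S^p)^*`. -/
def quotEquivDual [FiniteDimensional ℝ V] (p : ℕ) :
    MVQuot D.S p ≃ₗ[ℝ] Module.Dual ℝ (D.S p) :=
  LinearEquiv.ofBijective (D.evalQuot p) (D.evalQuot_bijective p)

/-- The contraction `ι_Φ α` with `Φ ∈ ⋀^k V^* ⊗ ⋁_n V / K_n` of `α ∈ S^n`, a `k`-form;
`ι_{θ ⊗ u} α = (ι_u α) θ`. -/
def iotaMulti (k : ℕ) (Φ : V [⋀^Fin k]→ₗ[ℝ] MVQuot D.S n) (α : D.S n) : Form V k :=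
  ((D.evalQuot n).flip α).compAlternatingMap Φ

/-- `♯̃_1 : (S^1)^{∧ b} → ⋀^{b-1} V^* ⊗ ⋁_n V / K_n` for `b = k + 1`, the dual of the pairing
`(α, β) ↦ (-1)^{n+1-b} ι_{♯_n(α)} β`. -/
def sharpOne [FiniteDimensional ℝ V] (k : ℕ) (β : D.wedgePow (k + 1)) :
    V [⋀^Fin k]→ₗ[ℝ] MVQuot D.S n :=
  (D.quotEquivDual n).symm.toLinearMap.compAlternatingMap
    { toFun := fun v =>
        { toFun := fun α => (-1 : ℝ) ^ ((n : ℤ) - k) *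
            D.contractVec k ⟨β.1, D.wedgePow_le_killed k β.2⟩ (D.sharpTop α) v
          map_add' := fun α α' => by simp [mul_add]
          map_smul' := fun c α => by simp; ring }
      map_update_add' := fun v i x y => by ext α; simp [mul_add]
      map_update_smul' := fun v i c x => by ext α; simp; ring
      map_eq_zero_of_eq' := fun v i j h hij => by
        ext α
        simp [AlternatingMap.map_eq_zero_of_eq _ v h hij] }

theorem iotaMulti_sharpOne [FiniteDimensional ℝ V] (k : ℕ) (β : D.wedgePow (k + 1)) (α : D.S n) :
    D.iotaMulti k (D.sharpOne k β) α = (-1 : ℝ) ^ ((n : ℤ) - k) •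
      D.contractVec k ⟨β.1, D.wedgePow_le_killed k β.2⟩ (D.sharpTop α) := by
  ext v
  exact LinearMap.congr_fun ((D.quotEquivDual n).apply_symm_apply _) α

/-- The defining property `ι_{♯_n(α)} β = (-1)^{n+1-b} ι_{♯̃_1(β)} α`, `b = k + 1`. -/
theorem sharpOne_spec [FiniteDimensional ℝ V] (k : ℕ) (β : D.wedgePow (k + 1)) (α : D.S n) :
    D.contractVec k ⟨β.1, D.wedgePow_le_killed k β.2⟩ (D.sharpTop α)
      = (-1 : ℝ) ^ ((n : ℤ) - k) • D.iotaMulti k (D.sharpOne k β) α := by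
  have hs : (-1 : ℝ) ^ ((n : ℤ) - k) * (-1 : ℝ) ^ ((n : ℤ) - k) = 1 := by
    rw [← mul_zpow]; simp
  rw [iotaMulti_sharpOne, smul_smul, hs, one_smul]

/-- `𝟙_n ∈ ⋀^n V^* ⊗ ⋁_n V / K_n`. -/
def oneTop : V [⋀^Fin n]→ₗ[ℝ] MVQuot D.S n :=
  (annih D.S n).mkQ.compAlternatingMap (exteriorPower.ιMulti ℝ n)

/-- A form is semi-basic if it is killed by every vector of the vertical space `vert`. -/
def IsSemibasic {W : Type*} [AddCommGroup W] [Module ℝ W] {k : ℕ} (vert : Submodule ℝ V)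
    (Φ : V [⋀^Fin k]→ₗ[ℝ] W) : Prop :=
  ∀ v : Fin k → V, (∃ i, v i ∈ vert) → Φ v = 0

end LinearDirac

namespace LinearDirac

variable {V : Type*} [AddCommGroup V] [Module ℝ V] [FiniteDimensional ℝ V] {m : ℕ}
  (D : LinearDirac V (m + 1))

/-- `ι_N α` for `N ∈ V^* ⊗ V / K_1` and `α ∈ S^a`, `a = k + 1 ≤ n = m + 1`. -/
def iotaS {k : ℕ} (hk : k + 1 ≤ m + 1) (N : V →ₗ[ℝ] V ⧸ D.K₁) (α : D.S (k + 1)) :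
    Form V (k + 1) :=
  D.iotaVec k N ⟨α.1, D.S_le_killed k hk α.2⟩

/-- `S^{n+1}[n]`, `n = m + 1`: the `Θ ∈ (S^1)^{∧(n+1)}` for which there is `N ∈ V^* ⊗ V / K_1`
with `ι_N α = ι_{♯̃_1(Θ)} α` for all `α ∈ S^n`. -/
def SExt : Submodule ℝ (Form V (m + 2)) where
  carrier := {Θ | ∃ h : Θ ∈ D.wedgePow (m + 2), ∃ N : V →ₗ[ℝ] V ⧸ D.K₁,
    ∀ α : D.S (m + 1), D.iotaS le_rfl N α = D.iotaMulti (m + 1) (D.sharpOne (m + 1) ⟨Θ, h⟩) α}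
  add_mem' := by
    rintro Θ Θ' ⟨h, N, hN⟩ ⟨h', N', hN'⟩
    refine ⟨add_mem h h', N + N', fun α => ?_⟩
    have h1 := hN α
    have h2 := hN' α
    rw [iotaMulti_sharpOne] at h1 h2 ⊢
    rw [iotaS] at h1 h2 ⊢
    rw [map_add, LinearMap.add_apply, h1, h2, ← smul_add, ← LinearMap.add_apply, ← map_add]
    rfl
  zero_mem' := by
    refine ⟨zero_mem _, 0, fun α => ?_⟩
    rw [iotaMulti_sharpOne, iotaS, map_zero, LinearMap.zero_apply]
    change 0 = _ • D.contractVec _ 0 _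
    simp
  smul_mem' := by
    rintro c Θ ⟨h, N, hN⟩
    refine ⟨Submodule.smul_mem _ c h, c • N, fun α => ?_⟩
    have h1 := hN α
    rw [iotaMulti_sharpOne] at h1 ⊢
    rw [iotaS] at h1 ⊢
    rw [map_smul, LinearMap.smul_apply, h1, smul_comm]
    congr 1
    rw [← LinearMap.smul_apply, ← map_smul]
    rfl

theorem SExt_le : D.SExt ≤ D.wedgePow (m + 2) := fun _ h => h.1

/-- `♯̃_1(Θ) ∈ ⋀^n V^* ⊗ ⋁_n V / K_n` for `Θ ∈ S^{n+1}[n]`. -/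
def sharpOneTop (Θ : D.SExt) :
    V [⋀^Fin (m + 1)]→ₗ[ℝ] MVQuot D.S (m + 1) :=
  D.sharpOne (m + 1) ⟨Θ.1, D.SExt_le Θ.2⟩

/-- The transpose of `S^1 → B^*`, `θ ↦ θ - ι_N θ`, for a surjection `π : V → B`: the class
`γ(ξ) ∈ V / K_1` with `⟨θ, γ(ξ)⟩ = (θ - ι_N θ)(v)` for `θ ∈ S^1`, where `v` is a lift of `ξ`
(chosen linearly in `ξ`; it does not matter which one as soon as every `θ - ι_N θ` is
semi-basic). -/
def transposeLift {B : Type*} [AddCommGroup B] [Module ℝ B] (π : V →ₗ[ℝ] B)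
    (hπ : Function.Surjective π) (N : V →ₗ[ℝ] V ⧸ D.K₁) : B →ₗ[ℝ] V ⧸ D.K₁ :=
  (D.K₁.mkQ - N) ∘ₗ
    (π.exists_rightInverse_of_surjective (LinearMap.range_eq_top.2 hπ)).choose

/-- If `N v = v + K_1` for `π v = 0`, that is, if all `θ - ι_N θ` with `θ ∈ S^1` vanish on
`ker π`, every lift of `ξ` can be used to compute `γ(ξ)`. -/
theorem transposeLift_apply {B : Type*} [AddCommGroup B] [Module ℝ B] (π : V →ₗ[ℝ] B)
    (hπ : Function.Surjective π) (N : V →ₗ[ℝ] V ⧸ D.K₁)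
    (hN : ∀ v, π v = 0 → N v = D.K₁.mkQ v) (v : V) :
    D.transposeLift π hπ N (π v) = D.K₁.mkQ v - N v := by
  have hs := (π.exists_rightInverse_of_surjective (LinearMap.range_eq_top.2 hπ)).choose_spec
  rw [transposeLift, LinearMap.comp_apply]
  set s := (π.exists_rightInverse_of_surjective (LinearMap.range_eq_top.2 hπ)).choose
  have h : π (v - s (π v)) = 0 := by
    rw [map_sub, sub_eq_zero]
    exact (LinearMap.congr_fun hs (π v)).symm
  have h1 := hN _ h
  rw [map_sub, map_sub, ← sub_eq_zero] at h1
  rw [LinearMap.sub_apply, ← sub_eq_zero, ← h1]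
  abel

end LinearDirac

/-! ### Differential forms and multivector fields on manifolds -/

section Fields

variable {E : Type*} [NormedAddCommGroup E] [NormedSpace ℝ E] [FiniteDimensional ℝ E]

instance finiteDimensional_tangentSpace {M : Type*} [TopologicalSpace M] [ChartedSpace E M]
    (x : M) : FiniteDimensional ℝ (TangentSpace 𝓘(ℝ, E) x) :=
  inferInstanceAs (FiniteDimensional ℝ E)

theorem continuous_form {k : ℕ} (f : Form E k) : Continuous f := by
  let b := Module.finBasis ℝ E
  have h : ∀ v : Fin k → E, f v = ∑ r : Fin k → Fin (Module.finrank ℝ E),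
      (∏ i, b.repr (v i) (r i)) • f (fun i => b (r i)) := by
    intro v
    conv_lhs => rw [show v = fun i => ∑ j, b.repr (v i) j • b j from
      funext fun i => (b.sum_repr (v i)).symm]
    rw [← AlternatingMap.coe_multilinearMap, MultilinearMap.map_sum]
    exact Finset.sum_congr rfl fun r _ => MultilinearMap.map_smul_univ _ _ _
  rw [show (f : (Fin k → E) → ℝ) = _ from funext h]
  refine continuous_finsetSum _ fun r _ => Continuous.mul
    (continuous_finsetProd _ fun i _ => ?_) continuous_const
  exact (LinearMap.continuous_of_finiteDimensional (b.coord (r i))).comp (continuous_apply i)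

/-- Forms on a finite-dimensional space are continuous. -/
def toCont {k : ℕ} (f : Form E k) : E [⋀^Fin k]→L[ℝ] ℝ := { f with cont := continuous_form f }

variable (E) (M : Type*) [TopologicalSpace M] [ChartedSpace E M]

/-- (Not necessarily smooth) differential `k`-forms on `M`. -/
abbrev DForm (k : ℕ) := ∀ x : M, Form (TangentSpace 𝓘(ℝ, E) x) k

/-- Inhomogeneous differential forms on `M`. -/
abbrev GDForm := ∀ x : M, GForm (TangentSpace 𝓘(ℝ, E) x)

/-- (Not necessarily smooth) `p`-vector fields on `M`. -/
abbrev MVField (p : ℕ) := ∀ x : M, ⋀[ℝ]^p (TangentSpace 𝓘(ℝ, E) x)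

variable {E M}

/-- The expression of a differential form in the chart at `x₀`. -/
def inChart {k : ℕ} (x₀ : M) (η : DForm E M k) (y : E) : E [⋀^Fin k]→L[ℝ] ℝ :=
  toCont ((η ((chartAt E x₀).symm y)).compLinearMap
    (mfderiv 𝓘(ℝ, E) 𝓘(ℝ, E) (chartAt E x₀).symm y).toLinearMap)

/-- Smoothness of a differential form. -/
def SmoothForm {k : ℕ} (η : DForm E M k) : Prop :=
  ∀ x₀ : M, ContDiffOn ℝ ∞ (inChart x₀ η) (chartAt E x₀).target

/-- The exterior derivative. -/
def extD {k : ℕ} (η : DForm E M k) : DForm E M (k + 1) := fun x =>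
  (extDeriv (inChart x η) (chartAt E x x)).toAlternatingMap.compLinearMap
    (mfderiv 𝓘(ℝ, E) 𝓘(ℝ, E) (chartAt E x) x).toLinearMap

/-- The exterior derivative of an inhomogeneous form. -/
def gextD (η : GDForm E M) : GDForm E M := fun x k =>
  match k with
  | 0 => 0
  | k + 1 => extD (fun y => η y k) x

/-- A homogeneous differential form as an inhomogeneous one. -/
def ghomog {k : ℕ} (α : DForm E M k) : GDForm E M := fun x => homog (α x)

/-- The contraction `ι_U η`. -/
def iota {p : ℕ} (U : MVField E M p) (η : GDForm E M) : GDForm E M := fun x =>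
  contract (U x : ExteriorAlgebra ℝ (TangentSpace 𝓘(ℝ, E) x)) (η x)

/-- The Lie derivative `£_U η = d ι_U η - (-1)^p ι_U d η` along a `p`-vector field. -/
def lieD {p : ℕ} (U : MVField E M p) (η : GDForm E M) : GDForm E M :=
  gextD (iota U η) - (-1 : ℝ) ^ p • iota U (gextD η)

/-- Smoothness of a multivector field: its pairing with every smooth form is smooth. -/
def SmoothMV {p : ℕ} (U : MVField E M p) : Prop :=
  ∀ η : DForm E M p, SmoothForm η →
    ContMDiff 𝓘(ℝ, E) 𝓘(ℝ, ℝ) ∞ fun x => exteriorPower.alternatingMapLinearEquiv (η x) (U x)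

/-- Smoothness of a vector field. -/
def SmoothVF [IsManifold 𝓘(ℝ, E) ∞ M] (Y : ∀ x : M, TangentSpace 𝓘(ℝ, E) x) : Prop :=
  ContMDiff 𝓘(ℝ, E) 𝓘(ℝ, E).tangent ∞ fun x => (⟨x, Y x⟩ : TangentBundle 𝓘(ℝ, E) M)

/-- `W` is the Schouten–Nijenhuis bracket `[U, V]` of a `p`- and a `q`-vector field
(`p, q ≥ 1`, `r = p + q - 1`), characterized by
`ι_{[U, V]} = (-1)^{(p-1)q} £_U ι_V - ι_V £_U` on smooth forms. -/
def IsSchouten {p q r : ℕ} (U : MVField E M p) (V : MVField E M q) (W : MVField E M r) : Prop :=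
  r + 1 = p + q ∧ ∀ η : GDForm E M, (∀ k, SmoothForm fun x => η x k) →
    iota W η = (-1 : ℝ) ^ ((p - 1) * q) • lieD U (iota V η) - iota V (lieD U η)

variable (E M)

/-- A regular graded Dirac structure of order `n` on `M`. -/
structure RegularGradedDirac (n : ℕ) where
  /-- The structure at each point. -/
  pt : ∀ x : M, LinearDirac (TangentSpace 𝓘(ℝ, E) x) n
  /-- The `S^a` are vector subbundles: they have smooth local frames. -/
  subbundle : ∀ a, 1 ≤ a → a ≤ n → ∀ x₀ : M, ∃ (r : ℕ) (σ : Fin r → DForm E M a),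
    (∀ i, SmoothForm (σ i)) ∧ ∀ᶠ x in 𝓝 x₀, LinearIndependent ℝ (fun i => σ i x) ∧
      Submodule.span ℝ (Set.range fun i => σ i x) = (pt x).S a
  /-- The `♯_a` are vector bundle maps: they map smooth sections to sections which, locally, are
  classes of smooth multivector fields. -/
  smooth : ∀ (a p : ℕ) (ha : a + p = n + 1), 1 ≤ a → 1 ≤ p →
    ∀ (α : DForm E M a) (hα : ∀ x, α x ∈ (pt x).S a), SmoothForm α → ∀ x₀ : M,
      ∃ U : MVField E M p, SmoothMV U ∧
        ∀ᶠ x in 𝓝 x₀, (pt x).sharp a p ha ⟨α x, hα x⟩ = Submodule.Quotient.mk (U x)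
  /-- Integrability. Here `c = a + b - n ≥ 1`. -/
  integrable : ∀ (a b c p q r : ℕ) (ha : a + p = n + 1) (hb : b + q = n + 1)
    (hc : c + r = n + 1), 1 ≤ a → 1 ≤ b → 1 ≤ c → 1 ≤ p → 1 ≤ q → r + 1 = p + q →
    ∀ (α : DForm E M a) (hα : ∀ x, α x ∈ (pt x).S a) (β : DForm E M b)
      (hβ : ∀ x, β x ∈ (pt x).S b) (U : MVField E M p) (V : MVField E M q),
      SmoothForm α → SmoothForm β → SmoothMV U → SmoothMV V →
      (∀ x, (pt x).sharp a p ha ⟨α x, hα x⟩ = Submodule.Quotient.mk (U x)) →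
      (∀ x, (pt x).sharp b q hb ⟨β x, hβ x⟩ = Submodule.Quotient.mk (V x)) →
      ∀ θ : GDForm E M,
        θ = (-1 : ℝ) ^ ((p - 1) * q) • lieD U (ghomog β) + (-1 : ℝ) ^ q • lieD V (ghomog α)
          - ((-1 : ℝ) ^ q / 2) •
            gextD (iota V (ghomog α) + (-1 : ℝ) ^ (p * q) • iota U (ghomog β)) →
      ∃ hθ : ∀ x, θ x c ∈ (pt x).S c, ∀ W : MVField E M r, IsSchouten U V W →
        ∀ x, (pt x).sharp c r hc ⟨θ x c, hθ x⟩ = Submodule.Quotient.mk (W x)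

end Fields

/-! ### Fibered structures, Hamiltonians and their dynamics -/

section Dynamics

variable {E : Type*} [NormedAddCommGroup E] [NormedSpace ℝ E] [FiniteDimensional ℝ E]
  {M : Type*} [TopologicalSpace M] [ChartedSpace E M]
  [IsManifold 𝓘(ℝ, E) ∞ M]
  {F : Type*} [NormedAddCommGroup F] [NormedSpace ℝ F] [FiniteDimensional ℝ F]
  {X : Type*} [TopologicalSpace X] [ChartedSpace F X] [IsManifold 𝓘(ℝ, F) ∞ X]

/-- The differential of `τ` at `x`. -/
def dMap (τ : M → X) (x : M) : TangentSpace 𝓘(ℝ, E) x →ₗ[ℝ] TangentSpace 𝓘(ℝ, F) (τ x) :=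
  (mfderiv 𝓘(ℝ, E) 𝓘(ℝ, F) τ x).toLinearMap

/-- The vertical vectors at `x`. -/
def vert (τ : M → X) (x : M) : Submodule ℝ (TangentSpace 𝓘(ℝ, E) x) :=
  LinearMap.ker (dMap (E := E) (F := F) τ x)

/-- `τ : M → X` is a fibered manifold. -/
structure IsFiberedManifold (τ : M → X) : Prop where
  smooth : ContMDiff 𝓘(ℝ, E) 𝓘(ℝ, F) ∞ τ
  surjective : Function.Surjective τ
  submersion : ∀ x, Function.Surjective (dMap (E := E) (F := F) τ x)

/-- The graded Dirac structure is fibered over `X` (`dim X = n`): `S^a` consists of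
`(a-1)`-horizontal forms, that is, forms vanishing on every pair of vertical vectors, and contains
all semi-basic `a`-forms. -/
structure IsFibered {n : ℕ} (D : RegularGradedDirac E M n) (τ : M → X) : Prop where
  fibered : IsFiberedManifold (E := E) (F := F) τ
  dim_base : Module.finrank ℝ F = n
  horizontal : ∀ a, 1 ≤ a → a ≤ n → ∀ x, ∀ α ∈ (D.pt x).S a,
    ∀ (v : Fin a → TangentSpace 𝓘(ℝ, E) x) (i j : Fin a), i ≠ j →
      v i ∈ vert (F := F) τ x → v j ∈ vert (F := F) τ x → α v = 0
  semibasic : ∀ a, 1 ≤ a → a ≤ n → ∀ x, ∀ α : Form (TangentSpace 𝓘(ℝ, E) x) a,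
    LinearDirac.IsSemibasic (vert (F := F) τ x) α → α ∈ (D.pt x).S a

/-- The horizontal lift of a (smooth) Ehresmann connection on `τ : M → X`. -/
structure EhresmannConnection (E F : Type*) [NormedAddCommGroup E] [NormedSpace ℝ E]
    [NormedAddCommGroup F] [NormedSpace ℝ F] {M X : Type*} [TopologicalSpace M]
    [ChartedSpace E M] [IsManifold 𝓘(ℝ, E) ∞ M] [TopologicalSpace X] [ChartedSpace F X]
    [IsManifold 𝓘(ℝ, F) ∞ X] (τ : M → X) where
  lift : ∀ x : M, TangentSpace 𝓘(ℝ, F) (τ x) →ₗ[ℝ] TangentSpace 𝓘(ℝ, E) x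
  section_of : ∀ (x : M) (ξ : TangentSpace 𝓘(ℝ, F) (τ x)),
    dMap (E := E) (F := F) τ x (lift x ξ) = ξ
  smooth : ∀ Y : (∀ y : X, TangentSpace 𝓘(ℝ, F) y), SmoothVF Y →
    SmoothVF fun x : M => lift x (Y (τ x))

/-- `h^* η`: the semi-basic form `(h^* η)(v₁, …) = η(h(dτ v₁), …)` on `M`. -/
def EhresmannConnection.pullback {τ : M → X} (h : EhresmannConnection E F τ) {k : ℕ}
    (η : DForm E M k) : DForm E M k := fun x =>
  (η x).compLinearMap (h.lift x ∘ₗ dMap (E := E) (F := F) τ x)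

/-- `deg_H` of an `a`-form. -/
def degH (n a : ℕ) : ℤ := (n : ℤ) - 1 - a

/-- `Ω^a_H(M)`, `0 ≤ a ≤ n - 1`. -/
structure HamiltonianForm {n : ℕ} (D : RegularGradedDirac E M n) (a : ℕ) where
  form : DForm E M a
  smooth : SmoothForm form
  degree : a + 1 ≤ n
  mem : ∀ x, extD form x ∈ (D.pt x).S (a + 1)

variable {m : ℕ} (D : RegularGradedDirac E M (m + 1))

/-- `Ω^n_H(M)[n]`, `n = m + 1`. -/
structure TopHamiltonianForm where
  form : DForm E M (m + 1)
  smooth : SmoothForm form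
  mem : ∀ x, extD form x ∈ (D.pt x).SExt

variable {D}

/-- `♯̃_1(d𝓗)` at `x`. -/
def TopHamiltonianForm.sharpOne (H : TopHamiltonianForm D) (x : M) :
    TangentSpace 𝓘(ℝ, E) x [⋀^Fin (m + 1)]→ₗ[ℝ] MVQuot (D.pt x).S (m + 1) :=
  (D.pt x).sharpOneTop ⟨extD H.form x, H.mem x⟩

/-- `𝓗` is a Hamiltonian: `-♯̃_1(d𝓗) + 𝟙_n` is semi-basic and contracting it with a semi-basic
`n`-form (an element of `S^n`) gives back this form. -/
structure IsHamiltonian (τ : M → X) (H : TopHamiltonianForm D) : Prop where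
  semibasic : ∀ x,
    LinearDirac.IsSemibasic (vert (F := F) τ x) (-H.sharpOne x + (D.pt x).oneTop)
  identity : ∀ x, ∀ η : (D.pt x).S (m + 1), LinearDirac.IsSemibasic (vert (F := F) τ x) η.1 →
    (D.pt x).iotaMulti (m + 1) (-H.sharpOne x + (D.pt x).oneTop) η = η.1

/-- The bracket `{α, 𝓗}_{♯̃_1} = (-1)^{deg_H 𝓗} ι_{♯̃_1(d𝓗)} dα` for `α ∈ Ω^{n-1}_H(M)`. -/
def bracketOne (α : HamiltonianForm D m) (H : TopHamiltonianForm D) : DForm E M (m + 1) :=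
  fun x => (-1 : ℝ) ^ degH (m + 1) (m + 1) •
    (D.pt x).iotaMulti (m + 1) (H.sharpOne x) ⟨extD α.form x, α.mem x⟩

/-- The connection `h` solves the Hamilton–De Donder–Weyl equations of `𝓗`:
`h^*(dα) = dα + {α, 𝓗}_{♯̃_1}` for all `α ∈ Ω^{n-1}_H(M)`. -/
def SolvesHDW {τ : M → X} (h : EhresmannConnection E F τ) (H : TopHamiltonianForm D) : Prop :=
  ∀ α : HamiltonianForm D m, h.pullback (extD α.form) = extD α.form + bracketOne α H

variable (D)

/-- An extension `♯̃_n : S^{n+1}[n] → T^*M ⊗ TM / K_1`: a smooth bundle map with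
`ι_{♯̃_n(Θ)} α = ι_{♯̃_1(Θ)} α` for `α ∈ S^n`. -/
structure Extension where
  map : ∀ x : M, (D.pt x).SExt →ₗ[ℝ]
    (TangentSpace 𝓘(ℝ, E) x →ₗ[ℝ] TangentSpace 𝓘(ℝ, E) x ⧸ (D.pt x).K₁)
  compatible : ∀ (x : M) (Θ : (D.pt x).SExt) (α : (D.pt x).S (m + 1)),
    (D.pt x).iotaS le_rfl (map x Θ) α = (D.pt x).iotaMulti (m + 1) ((D.pt x).sharpOneTop Θ) α
  smooth : ∀ (Θ : DForm E M (m + 2)) (hΘ : ∀ x, Θ x ∈ (D.pt x).SExt), SmoothForm Θ →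
    ∀ Y : (∀ x : M, TangentSpace 𝓘(ℝ, E) x), SmoothVF Y → ∀ x₀ : M,
      ∃ Z : (∀ x : M, TangentSpace 𝓘(ℝ, E) x), SmoothVF Z ∧
        ∀ᶠ x in 𝓝 x₀, map x ⟨Θ x, hΘ x⟩ (Y x) = Submodule.Quotient.mk (Z x)

variable {D}

/-- `♯̃_n(d𝓗)` at `x`. -/
def Extension.onHam (e : Extension D) (H : TopHamiltonianForm D) (x : M) :
    TangentSpace 𝓘(ℝ, E) x →ₗ[ℝ] TangentSpace 𝓘(ℝ, E) x ⧸ (D.pt x).K₁ :=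
  e.map x ⟨extD H.form x, H.mem x⟩

/-- `♯̃_n(d𝓗)` takes vertical values. -/
def Extension.IsVerticalAt (e : Extension D) (τ : M → X) (H : TopHamiltonianForm D) : Prop :=
  ∀ (x : M) (v : TangentSpace 𝓘(ℝ, E) x),
    ∃ w ∈ vert (F := F) τ x, e.onHam H x v = Submodule.Quotient.mk w

/-- The bracket `{α, 𝓗}_{♯̃_n} = (-1)^{deg_H 𝓗} ι_{♯̃_n(d𝓗)} dα` for `α ∈ Ω^a_H(M)`. -/
def Extension.bracket (e : Extension D) {a : ℕ} (α : HamiltonianForm D a)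
    (H : TopHamiltonianForm D) : DForm E M (a + 1) := fun x =>
  (-1 : ℝ) ^ degH (m + 1) (m + 1) •
    (D.pt x).iotaS α.degree (e.onHam H x) ⟨extD α.form x, α.mem x⟩

/-- `γ_𝓗 : τ^* TX → TM / K_1`, the transpose of `θ ↦ θ - ι_{♯̃_n(d𝓗)} θ` on `S^1`. -/
def Extension.gamma (e : Extension D) {τ : M → X} (hτ : IsFibered (F := F) D τ)
    (H : TopHamiltonianForm D) (x : M) :
    TangentSpace 𝓘(ℝ, F) (τ x) →ₗ[ℝ] TangentSpace 𝓘(ℝ, E) x ⧸ (D.pt x).K₁ :=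
  (D.pt x).transposeLift (dMap (E := E) (F := F) τ x) (hτ.fibered.submersion x) (e.onHam H x)

end Dynamics

end GradedDirac

end

/-!
The theorem is a statement of linear algebra at each point `x` of `M`. Write `V` for the tangent
space at `x`, `π` for the differential of `τ`, `N : V → V / K_1` for `♯̃_n(d𝓗)`, and `n = m + 1`.

If `w i` represents `N (v i)`, then `(ι_N α)(v) = ∑ i, α(v with v i replaced by w i)`
(`iotaS_apply`), the part of `α(v + w)` that is linear in `w`. As `N` takes vertical values and
`α ∈ S^a` vanishes on pairs of vertical vectors, the remaining terms of higher order drop out, and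
`α(v - w) = α(v) - (ι_N α)(v)` whenever the `w i` are vertical (`map_sub_of_vertical`). So it is
enough that the horizontal projection `P = h ∘ π` satisfies `v - P v ∈ N v` for every `v`, for then
`w i = v i - P (v i)` is an admissible choice.

By definition of `γ_𝓗`, this holds as soon as `N v = v + K_1` for vertical `v`, and that is where
the Hamiltonian enters: `♯̃_1(d𝓗)` and `N` contract elements of `S^n` in the same way, hence
`α - ι_N α` is semi-basic for `α ∈ S^n`. Evaluated on a tuple starting with a vertical vector `v`,
it reduces to `ι_{v - w} α` with `w` representing `N v`, because all other terms contain two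
vertical vectors. A vector that contracts `S^n` to zero lies in `K_1`, since each `S^a` is spanned
by the contractions of `S^{a+1}` (`mem_annihVec_of_curryLeft_top`).

The Hamilton–De Donder–Weyl equations are the case `a = n - 1`, because both brackets agree there.
-/

namespace GradedDirac

/-! ### Alternating forms that vanish on pairs of vertical vectors -/

section Vertical

variable {V : Type*} [AddCommGroup V] [Module ℝ V]

/-- If `α` vanishes on pairs of vectors of `K`, the expansion of `α (v - w)` for `w i ∈ K` stops
after the terms of first order in `w`. -/
theorem map_sub_of_vertical {k : ℕ} (K : Submodule ℝ V) (α : Form V k)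
    (hα : ∀ (v : Fin k → V) (i j : Fin k), i ≠ j → v i ∈ K → v j ∈ K → α v = 0)
    (v w : Fin k → V) (hw : ∀ i, w i ∈ K) :
    α (v - w) = α v - ∑ i, α (Function.update v i (w i)) := by
  have h := α.toMultilinearMap.map_add_eq_map_add_linearDeriv_add v (-w)
  have h0 : ∑ s : Finset (Fin k) with 2 ≤ s.card,
      α.toMultilinearMap (s.piecewise (-w) v) = 0 := by
    refine Finset.sum_eq_zero fun s hs => ?_
    obtain ⟨i, hi, j, hj, hij⟩ := Finset.one_lt_card.1 (Finset.mem_filter.1 hs).2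
    refine hα _ i j hij ?_ ?_
    · simpa [hi] using hw i
    · simpa [hj] using hw j
  rw [h0, add_zero, MultilinearMap.linearDeriv_apply] at h
  simpa [sub_eq_add_neg, AlternatingMap.map_update_neg] using h

end Vertical

/-! ### Contractions with vector-valued one-forms -/

namespace LinearDirac

variable {V : Type*} [AddCommGroup V] [Module ℝ V] {m : ℕ} (D : LinearDirac V (m + 1))

/-- A vector whose contraction with every element of `S^n` is zero lies in `K_1`: by the chain
condition, the property passes from `S^{a+1}` to `S^a`. -/
theorem mem_annihVec_of_curryLeft_top (u : V)
    (hu : ∀ α ∈ D.S (m + 1), α.curryLeft u = 0) : u ∈ D.K₁ := by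
  have key : ∀ k ≤ m, ∀ α ∈ D.S (k + 1), α.curryLeft u = 0 := by
    intro k hk
    induction hk using Nat.decreasingInduction with
    | self => exact hu
    | of_succ k hk ih =>
      intro α hα
      rw [D.chain (k + 1) (by omega) (by omega)] at hα
      induction hα using Submodule.span_induction with
      | mem α h =>
        obtain ⟨β, hβ, v, rfl⟩ := h
        -- `ι_u ι_v β = -ι_v ι_u β = 0`
        have h := β.curryLeft_same (u + v)
        simpa [ih β hβ] using h
      | zero => simp
      | add α β _ _ h h' => simp [h, h']
      | smul c α _ h => simp [h]
  intro θ hθ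
  have h := DFunLike.congr_fun (key 0 (Nat.zero_le m) θ hθ) ![]
  rw [AlternatingMap.curryLeft_apply_apply, AlternatingMap.zero_apply] at h
  rw [← h]
  congr 1
  ext i
  rw [Subsingleton.elim i 0]; rfl

/-- `ι_N α` is the derivation-like sum replacing each `v i` by a representative of `N (v i)`. -/
theorem iotaS_apply {k : ℕ} (hk : k + 1 ≤ m + 1) (N : V →ₗ[ℝ] V ⧸ D.K₁) (α : D.S (k + 1))
    (v w : Fin (k + 1) → V) (hw : ∀ i, N (v i) = Submodule.Quotient.mk (w i)) :
    D.iotaS hk N α v = ∑ i, α.1 (Function.update v i (w i)) := by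
  change AlternatingMap.alternatizeUncurryFin _ v = _
  rw [AlternatingMap.alternatizeUncurryFin_apply]
  refine Finset.sum_congr rfl fun i _ => ?_
  rw [LinearMap.comp_apply, hw, ← Fin.insertNth_removeNth, AlternatingMap.map_insertNth]
  rfl

/-- `ι_{𝟙_n} α = α`. -/
theorem iotaMulti_oneTop (α : D.S (m + 1)) : D.iotaMulti (m + 1) D.oneTop α = α.1 := by
  ext v
  exact exteriorPower.alternatingMapLinearEquiv_apply_ιMulti α.1 v

/-- If `N` takes vertical values and `α - ι_N α` is semi-basic for all `α ∈ S^n`, then `N` is the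
identity modulo `K_1` on vertical vectors. -/
theorem eq_mkQ_of_isSemibasic (K : Submodule ℝ V) (N : V →ₗ[ℝ] V ⧸ D.K₁)
    (hN : ∀ v, ∃ w ∈ K, N v = Submodule.Quotient.mk w)
    (hS : ∀ α ∈ D.S (m + 1), ∀ (v : Fin (m + 1) → V) (i j : Fin (m + 1)), i ≠ j →
      v i ∈ K → v j ∈ K → α v = 0)
    (hb : ∀ α : D.S (m + 1), IsSemibasic K (α.1 - D.iotaS le_rfl N α))
    (v : V) (hv : v ∈ K) : N v = D.K₁.mkQ v := by
  choose w hwK hw using hN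
  rw [hw, Submodule.mkQ_apply, eq_comm, Submodule.Quotient.eq]
  refine D.mem_annihVec_of_curryLeft_top _ fun α hα => ?_
  ext u
  have h := hb ⟨α, hα⟩ (Matrix.vecCons v u) ⟨0, hv⟩
  rw [AlternatingMap.sub_apply, D.iotaS_apply le_rfl N ⟨α, hα⟩ _ _ fun i => hw _,
    Fin.sum_univ_succ, Finset.sum_eq_zero, add_zero] at h
  · rw [map_sub]
    simpa [Matrix.vecCons] using h
  · intro i _
    refine hS α hα _ 0 i.succ (Fin.succ_ne_zero i).symm ?_ ?_
    · simpa [Function.update_of_ne (Fin.succ_ne_zero i).symm] using hv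
    · simpa using hwK _

end LinearDirac

/-! ### Hamiltonians and horizontal lifts -/

section Dynamics

variable {E : Type*} [NormedAddCommGroup E] [NormedSpace ℝ E] [FiniteDimensional ℝ E]
  {M : Type*} [TopologicalSpace M] [ChartedSpace E M]
  [IsManifold 𝓘(ℝ, E) ∞ M]
  {F : Type*} [NormedAddCommGroup F] [NormedSpace ℝ F]
  {X : Type*} [TopologicalSpace X] [ChartedSpace F X] [IsManifold 𝓘(ℝ, F) ∞ X]
  {m : ℕ} {D : RegularGradedDirac E M (m + 1)} {τ : M → X} {H : TopHamiltonianForm D}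

omit [IsManifold 𝓘(ℝ, F) ∞ X] in
/-- Both `♯̃_n(d𝓗)` and `♯̃_1(d𝓗)` contract `S^n` in the same way, so the semi-basicity of
`-♯̃_1(d𝓗) + 𝟙_n` carries over to `α - ι_{♯̃_n(d𝓗)} α`. -/
theorem IsHamiltonian.isSemibasic_sub_iotaS (hH : IsHamiltonian (F := F) τ H) (e : Extension D)
    (x : M) (α : (D.pt x).S (m + 1)) :
    LinearDirac.IsSemibasic (vert (F := F) τ x)
      (α.1 - (D.pt x).iotaS le_rfl (e.onHam H x) α) := by
  intro v hv
  have h1 : (D.pt x).iotaMulti (m + 1) (-H.sharpOne x + (D.pt x).oneTop) α v = 0 := by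
    change (D.pt x).evalQuot (m + 1) ((-H.sharpOne x + (D.pt x).oneTop) v) α = 0
    rw [hH.semibasic x v hv, map_zero, LinearMap.zero_apply]
  have h2 : (D.pt x).iotaMulti (m + 1) (-H.sharpOne x + (D.pt x).oneTop) α v
      = -(D.pt x).iotaMulti (m + 1) (H.sharpOne x) α v
        + (D.pt x).iotaMulti (m + 1) (D.pt x).oneTop α v := by
    simp [LinearDirac.iotaMulti]
  rw [h2, LinearDirac.iotaMulti_oneTop] at h1
  rw [Extension.onHam, e.compatible, AlternatingMap.sub_apply, sub_eq_neg_add]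
  exact h1

omit [IsManifold 𝓘(ℝ, F) ∞ X] in
/-- On vertical vectors, `♯̃_n(d𝓗)` is the identity modulo `K_1`. -/
theorem Extension.onHam_of_mem_vert (hτ : IsFibered (F := F) D τ)
    (hH : IsHamiltonian (F := F) τ H) (e : Extension D) (he : e.IsVerticalAt (F := F) τ H)
    (x : M) (v : TangentSpace 𝓘(ℝ, E) x) (hv : v ∈ vert (F := F) τ x) :
    e.onHam H x v = (D.pt x).K₁.mkQ v :=
  (D.pt x).eq_mkQ_of_isSemibasic (vert (F := F) τ x) _ (he x)
    (hτ.horizontal (m + 1) (by omega) le_rfl x) (hH.isSemibasic_sub_iotaS e x) v hv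

omit [FiniteDimensional ℝ E] in
theorem EhresmannConnection.sub_lift_mem_vert (h : EhresmannConnection E F τ) (x : M)
    (v : TangentSpace 𝓘(ℝ, E) x) :
    v - h.lift x (dMap (F := F) τ x v) ∈ vert (F := F) τ x := by
  rw [vert, LinearMap.mem_ker, map_sub, h.section_of, sub_self]

/-- The vertical part of `v` represents `♯̃_n(d𝓗)(v)` when `h` lifts `γ_𝓗`. -/
theorem Extension.onHam_eq_mk_sub_lift (hτ : IsFibered (F := F) D τ)
    (hH : IsHamiltonian (F := F) τ H) (e : Extension D) (he : e.IsVerticalAt (F := F) τ H)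
    (h : EhresmannConnection E F τ)
    (hγ : ∀ (x : M) (ξ : TangentSpace 𝓘(ℝ, F) (τ x)),
      Submodule.Quotient.mk (h.lift x ξ) = e.gamma hτ H x ξ)
    (x : M) (v : TangentSpace 𝓘(ℝ, E) x) :
    e.onHam H x v = Submodule.Quotient.mk (v - h.lift x (dMap (F := F) τ x v)) := by
  rw [Submodule.Quotient.mk_sub, hγ, Extension.gamma,
    (D.pt x).transposeLift_apply _ _ _ fun w hw => e.onHam_of_mem_vert hτ hH he x w hw]
  simp

theorem bracketOne_eq_bracket (e : Extension D) (α : HamiltonianForm D m) :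
    bracketOne α H = e.bracket α H := by
  funext x
  rw [bracketOne, Extension.bracket, Extension.onHam, e.compatible]
  rfl

theorem EhresmannConnection.pullback_extD (hτ : IsFibered (F := F) D τ)
    (hH : IsHamiltonian (F := F) τ H) (e : Extension D) (he : e.IsVerticalAt (F := F) τ H)
    (h : EhresmannConnection E F τ)
    (hγ : ∀ (x : M) (ξ : TangentSpace 𝓘(ℝ, F) (τ x)),
      Submodule.Quotient.mk (h.lift x ξ) = e.gamma hτ H x ξ)
    {a : ℕ} (α : HamiltonianForm D a) :
    h.pullback (extD α.form) = extD α.form + e.bracket α H := by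
  funext x
  ext v
  have hexp := map_sub_of_vertical (vert (F := F) τ x) (extD α.form x)
    (hτ.horizontal (a + 1) (by omega) α.degree x _ (α.mem x)) v
    (fun i => v i - h.lift x (dMap (F := F) τ x (v i))) fun i => h.sub_lift_mem_vert x (v i)
  have hiota := (D.pt x).iotaS_apply α.degree (e.onHam H x) ⟨extD α.form x, α.mem x⟩ v _
    fun i => e.onHam_eq_mk_sub_lift hτ hH he h hγ x (v i)
  have hP : (v - fun i => v i - h.lift x (dMap (F := F) τ x (v i)))
      = fun i => h.lift x (dMap (F := F) τ x (v i)) := by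
    funext i
    simp
  rw [hP, ← hiota] at hexp
  -- the sign of both brackets is `(-1) ^ (-1) = -1`
  have hsign : (-1 : ℝ) ^ degH (m + 1) (m + 1) = -1 := by
    have : degH (m + 1) (m + 1) = -1 := by simp [degH]
    rw [this]
    norm_num
  have hbr : e.bracket α H x v
      = -(D.pt x).iotaS α.degree (e.onHam H x) ⟨extD α.form x, α.mem x⟩ v := by
    change (-1 : ℝ) ^ degH (m + 1) (m + 1) * _ = _
    rw [hsign, neg_one_mul]
    rfl
  rw [Pi.add_apply, AlternatingMap.add_apply, hbr, ← sub_eq_add_neg]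
  exact hexp

end Dynamics

end GradedDirac

theorem mainTheorem2
    {E : Type*} [NormedAddCommGroup E] [NormedSpace ℝ E] [FiniteDimensional ℝ E]
    {M : Type*} [TopologicalSpace M] [T2Space M] [SecondCountableTopology M]
    [ChartedSpace E M] [IsManifold 𝓘(ℝ, E) ∞ M]
    {F : Type*} [NormedAddCommGroup F] [NormedSpace ℝ F] [FiniteDimensional ℝ F]
    {X : Type*} [TopologicalSpace X] [T2Space X] [SecondCountableTopology X]
    [ChartedSpace F X] [IsManifold 𝓘(ℝ, F) ∞ X]
    {m : ℕ} (D : GradedDirac.RegularGradedDirac E M (m + 1))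
    (τ : M → X) (hτ : GradedDirac.IsFibered (F := F) D τ)
    (H : GradedDirac.TopHamiltonianForm D) (hH : GradedDirac.IsHamiltonian (F := F) τ H)
    (e : GradedDirac.Extension D) (he : e.IsVerticalAt (F := F) τ H)
    (h : GradedDirac.EhresmannConnection E F τ)
    (hγ : ∀ (x : M) (ξ : TangentSpace 𝓘(ℝ, F) (τ x)),
      Submodule.Quotient.mk (h.lift x ξ) = e.gamma hτ H x ξ) :
    GradedDirac.SolvesHDW h H ∧
      ∀ (a : ℕ) (α : GradedDirac.HamiltonianForm D a),
        h.pullback (GradedDirac.extD α.form) = GradedDirac.extD α.form + e.bracket α H := by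
  have key {a : ℕ} (α : GradedDirac.HamiltonianForm D a) :=
    h.pullback_extD hτ hH e he hγ α
  exact ⟨fun α => by rw [GradedDirac.bracketOne_eq_bracket e, key], fun _ α => key α⟩
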